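/- Consider a qubit with Pauli matrices $\vec\sigma=(\sigma_x,\sigma_y,\sigma_z)$. Let $\hat n_1,\dots,\hat n_N$ be unit vectors in $\mathbb R^3$ (not necessarily distinct) such that the operators $E_j=\frac1N(\mathbf 1+\hat n_j\cdot\vec\sigma)$ form a POVM, that is, $0\le E_j\le\mathbf 1$ and $\sum_{j=1}^N E_j=\mathbf 1$ (the fiducial POVM). Consider the rotation-invariant class consisting of all the POVMs $\{\frac1N(\mathbf 1+(R\hat n_j)\cdot\vec\sigma)\}_{j=1}^N$ with $R\in SO(3)$. A frame function for this class is a function $f$ on the effects $\frac1N(\mathbf 1+\hat n\cdot\vec\sigma)$, $\hat n\in S^2$, with values in $[0,1]$, whose values on the effects of each POVM of the class, counted with multiplicity, sum to $1$. Write $F(\hat n)=f\bigl(\frac1N(\mathbf 1+\hat n\cdot\vec\sigma)\bigr)$, and let $c_{lm}=\int_{S^2}\overline{Y_{lm}}\,F\,d\Omega$ ($l\ge0$, $-l\le m\le l$) be the coefficients of $F$ in its expansion in the orthonormal spherical harmonics $Y_{lm}$. (a) (Frame conditions.) Let $f$ be a real function on these effects for which $F$ is continuous on the sphere. Then $f$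 is a frame function for the class if and only if $F\ge0$, $c_{00}=\sqrt{4\pi}/N$, and for every $l\ge1$ either $$c_{lm}=0\quad\text{for } m=-l,\dots,l,\qquad\text{or}\qquad \sum_{j=1}^N Y_{lr}(\hat n_j)=0\quad\text{for } r=-l,\dots,l .$$ (b) For every $l\ge1$, the $l$-th harmonic may appear, that is, there is a frame function $f$ for the class with $F$ continuous and $c_{lm}\ne0$ for some $m\in\{-l,\dots,l\}$, if and only if $\sum_{j=1}^N Y_{lr}(\hat n_j)=0$ for every $r=-l,\dots,l$. -/

import Mathlib

open MeasureTheory Polynomial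
open scoped Matrix ComplexConjugate ComplexOrder

noncomputable section

namespace QubitFrame

/-- Three-dimensional Euclidean space; coordinates `0, 1, 2` are `x, y, z`. -/
abbrev E3 : Type := EuclideanSpace ℝ (Fin 3)

/-- The unit sphere in three-dimensional Euclidean space. -/
abbrev S2 : Type := Metric.sphere (0 : E3) 1

/-- Operators on a qubit. -/
abbrev QubitOp : Type := Matrix (Fin 2) (Fin 2) ℂ

/-! ### Qubit measurements -/

/-- The Pauli matrices `σ_x, σ_y, σ_z`. -/
def pauli : Fin 3 → QubitOp :=
  ![!![0, 1; 1, 0], !![0, -Complex.I; Complex.I, 0], !![1, 0; 0, -1]]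

/-- The operator `(1 + u · σ) / N`. -/
def blochEffect (N : ℕ) (u : E3) : QubitOp :=
  (1 / (N : ℂ)) • (1 + ∑ k : Fin 3, ((u k : ℝ) : ℂ) • pauli k)

/-- A qubit effect: a Hermitian operator with spectrum in the unit interval, `0 ≤ E ≤ 1`. -/
def IsEffect (E : QubitOp) : Prop := E.PosSemidef ∧ (1 - E).PosSemidef

/-- A POVM with `N` outcomes: `N` effects that sum to the identity. -/
def IsPOVM {N : ℕ} (P : Fin N → QubitOp) : Prop :=
  (∀ j, IsEffect (P j)) ∧ ∑ j, P j = 1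

/-- The action of a `3 × 3` matrix on three-dimensional Euclidean space. -/
def rotate (R : Matrix (Fin 3) (Fin 3) ℝ) (u : E3) : E3 := WithLp.toLp 2 (R *ᵥ u.ofLp)

/-- The rotation-invariant class generated by the fiducial vectors `n_1, …, n_N`: all families
`((1 + (R n_j) · σ) / N)_j`, where `R` runs over the rotations of three-dimensional space. -/
def rotationClass {N : ℕ} (n : Fin N → S2) : Set (Fin N → QubitOp) :=
  {P | ∃ R ∈ Matrix.specialOrthogonalGroup (Fin 3) ℝ,
    ∀ j, P j = blochEffect N (rotate R (n j))}

/-- `f` is a frame function for a class of POVMs: on every effect that occurs in a POVM of the class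
it takes a value in `[0, 1]`, and its values on the effects of each POVM of the class sum to `1`.
Its values on other operators are irrelevant. -/
def IsFrameFunction {N : ℕ} (C : Set (Fin N → QubitOp)) (f : QubitOp → ℝ) : Prop :=
  (∀ P ∈ C, ∀ j, f (P j) ∈ Set.Icc (0 : ℝ) 1) ∧ ∀ P ∈ C, ∑ j, f (P j) = 1

/-- The function `F(u) = f((1 + u · σ) / N)` on the unit sphere. -/
def onSphere (N : ℕ) (f : QubitOp → ℝ) (u : S2) : ℝ := f (blochEffect N u)

/-! ### Spherical harmonics -/

/-- The Legendre polynomial `P_l`, by Rodrigues' formula. -/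
def legendre (l : ℕ) : ℝ[X] :=
  C (1 / (2 ^ l * (l.factorial : ℝ))) * derivative^[l] ((X ^ 2 - 1) ^ l)

/-- The spherical harmonic `Y_{lm}` for `0 ≤ m ≤ l`, with the Condon–Shortley phase, namely
`√((2l+1)/(4π) · (l-m)!/(l+m)!) P_l^m(cos θ) e^{imφ}`. Since
`P_l^m(x) = (-1)^m (1 - x²)^{m/2} (d/dx)^m P_l(x)` and `u_x + i u_y = sin θ e^{iφ}`, the factor
`P_l^m(cos θ) e^{imφ}` is `(-1)^m (d/dx)^m P_l (u_z) (u_x + i u_y)^m`. -/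
def sphericalHarmonicNonneg (l m : ℕ) (u : S2) : ℂ :=
  (Real.sqrt ((2 * l + 1) / (4 * Real.pi) *
      (((l - m).factorial : ℝ) / ((l + m).factorial : ℝ))) : ℂ) *
    ((-1) ^ m * (((derivative^[m] (legendre l)).eval (u.1 2) : ℝ) : ℂ) *
      (((u.1 0 : ℝ) : ℂ) + ((u.1 1 : ℝ) : ℂ) * Complex.I) ^ m)

/-- The spherical harmonic `Y_{lm}` for `-l ≤ m ≤ l`, where `Y_{l,-m} = (-1)^m conj Y_{lm}`. -/
def sphericalHarmonic (l : ℕ) (m : ℤ) (u : S2) : ℂ :=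
  if 0 ≤ m then sphericalHarmonicNonneg l m.natAbs u
  else (-1) ^ m.natAbs * conj (sphericalHarmonicNonneg l m.natAbs u)

/-- The coefficient `c_{lm} = ∫ conj Y_{lm} F dΩ` of `Y_{lm}` in the spherical-harmonic expansion
of `F`; `dΩ` is the surface measure, of total mass `4π`. -/
def harmonicCoeff (F : S2 → ℝ) (l : ℕ) (m : ℤ) : ℂ :=
  ∫ u : S2, conj (sphericalHarmonic l m u) * (F u : ℂ) ∂(volume : Measure E3).toSphere

/-- The `l`-th harmonic is present in `F`. -/
def ContainsHarmonic (F : S2 → ℝ) (l : ℕ) : Prop :=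
  ∃ m ∈ Set.Icc (-(l : ℤ)) l, harmonicCoeff F l m ≠ 0

/-- The sum condition: `∑_j Y_{lr}(n_j) = 0` for `r = -l, …, l`. -/
def SumCondition {N : ℕ} (n : Fin N → S2) (l : ℕ) : Prop :=
  ∀ r ∈ Set.Icc (-(l : ℤ)) l, ∑ j, sphericalHarmonic l r (n j) = 0

end QubitFrame

end

namespace QubitFrame

/-! ### Rotations of the sphere -/

/-! Both conditions in degree l are restated with the Legendre polynomial P_l. By the addition
theorem (`sum_sphericalHarmonic`), the coefficients c_{lm} all vanish iff the zonal component y ↦ ∫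
P_l(y·u) F(u) dΩ does, and the sum condition says that ∑_j P_l(n_j·x) = 0 for all x.

Frame function to harmonics: averaging F ∘ R over rotations about the z axis gives a function z of
the height with ∑_j z(n_j·w) = 2π for every w. Integrating this against P_l(w·x) and applying
Funk–Hecke gives `zonal_mul_sum_legendre`: (zonal component at y) · ∑_j P_l(n_j·x) = ∫ P_l(u·x) dΩ.
The right side is 0 for l ≥ 1, so one of the factors vanishes identically; l = 0 fixes c_{00}.

Harmonics to frame function (`sum_rot_eq_one`): the conditions give ∑_j ∫ p(R n_j·u) F(u) dΩ = ∫
p(u_z) dΩ for every Legendre polynomial p, hence for every polynomial. The kernels p = (1 + X)^k,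
normalized, concentrate at a point, so the limit is ∑_j F(R n_j) = 1. Convergence of the harmonic
expansion of F is never needed.

For (b), a constant plus a small multiple of P_l(u_z) is an explicit frame function; the converse is
read off from (a). -/

/-- The group of rotations of three-dimensional space. -/
abbrev SO3 : Type := Matrix.specialOrthogonalGroup (Fin 3) ℝ

/-- The inner product of two points of the sphere, in coordinates. -/
def dot (u v : S2) : ℝ := u.1.ofLp ⬝ᵥ v.1.ofLp

theorem dot_eq (u v : S2) : dot u v = u.1 0 * v.1 0 + u.1 1 * v.1 1 + u.1 2 * v.1 2 := by
  simp [dot, dotProduct, Fin.sum_univ_three]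

theorem dot_comm (u v : S2) : dot u v = dot v u := dotProduct_comm _ _

theorem dot_self (u : S2) : dot u u = 1 := by
  have h : ‖u.1‖ ^ 2 = 1 := by rw [norm_eq_of_mem_sphere u]; norm_num
  rw [EuclideanSpace.real_norm_sq_eq] at h
  simpa [dot, dotProduct, pow_two] using h

theorem sq_add_sq_add_sq (u : S2) : u.1 0 ^ 2 + u.1 1 ^ 2 + u.1 2 ^ 2 = 1 := by
  have h := dot_self u
  rw [dot_eq] at h
  linear_combination h

/-- A point of the sphere from its coordinates. -/
def mkS2 (x y z : ℝ) (h : x ^ 2 + y ^ 2 + z ^ 2 = 1) : S2 :=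
  ⟨!₂[x, y, z], by
    rw [mem_sphere_zero_iff_norm, EuclideanSpace.norm_eq, Fin.sum_univ_three]
    simp [h]⟩

/-- The north pole. -/
def pole : S2 := mkS2 0 0 1 (by norm_num)

theorem ext_S2 {u v : S2} (h0 : u.1 0 = v.1 0) (h1 : u.1 1 = v.1 1) (h2 : u.1 2 = v.1 2) :
    u = v := by
  apply Subtype.ext
  ext i
  fin_cases i
  · exact h0
  · exact h1
  · exact h2

theorem dot_pole (u : S2) : dot u pole = u.1 2 := by
  simp [dot_eq, pole, mkS2]

theorem eq_of_dot_eq_one {u v : S2} (h : dot u v = 1) : u = v := by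
  have hu := sq_add_sq_add_sq u
  have hv := sq_add_sq_add_sq v
  rw [dot_eq] at h
  have key : (u.1 0 - v.1 0) ^ 2 + (u.1 1 - v.1 1) ^ 2 + (u.1 2 - v.1 2) ^ 2 = 0 := by
    linear_combination hu + hv - 2 * h
  have h0 := sq_nonneg (u.1 0 - v.1 0)
  have h1 := sq_nonneg (u.1 1 - v.1 1)
  have h2 := sq_nonneg (u.1 2 - v.1 2)
  apply ext_S2 <;> apply sub_eq_zero.1 <;> apply pow_eq_zero_iff two_ne_zero |>.1 <;> linarith

theorem abs_dot_le_one (u v : S2) : |dot u v| ≤ 1 := by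
  have hu := sq_add_sq_add_sq u
  have hv := sq_add_sq_add_sq v
  rw [dot_eq, abs_le]
  constructor
  · nlinarith [sq_nonneg (u.1 0 + v.1 0), sq_nonneg (u.1 1 + v.1 1), sq_nonneg (u.1 2 + v.1 2)]
  · nlinarith [sq_nonneg (u.1 0 - v.1 0), sq_nonneg (u.1 1 - v.1 1), sq_nonneg (u.1 2 - v.1 2)]

theorem SO3.transpose_mul (R : SO3) : (R.1)ᵀ * R.1 = 1 := by
  have h := (Matrix.mem_specialOrthogonalGroup_iff.1 R.2).1
  exact (Matrix.mem_orthogonalGroup_iff' _ _).1 h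

theorem mulVec_dot_mulVec (R : SO3) (x y : Fin 3 → ℝ) :
    (R.1 *ᵥ x) ⬝ᵥ (R.1 *ᵥ y) = x ⬝ᵥ y := by
  rw [Matrix.dotProduct_mulVec, Matrix.vecMul_mulVec, SO3.transpose_mul, Matrix.vecMul_one]

/-- The action of a rotation on the sphere. -/
def rot (R : SO3) (u : S2) : S2 :=
  ⟨rotate R.1 u, by
    have h : ‖rotate R.1 u‖ ^ 2 = 1 := by
      have hu := dot_self u
      rw [dot, ← mulVec_dot_mulVec R] at hu
      rw [EuclideanSpace.real_norm_sq_eq]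
      simpa [rotate, dotProduct, pow_two] using hu
    rw [mem_sphere_zero_iff_norm]
    nlinarith [norm_nonneg (rotate R.1 u)]⟩

theorem rot_ofLp (R : SO3) (u : S2) : (rot R u).1.ofLp = R.1 *ᵥ u.1.ofLp := rfl

theorem dot_rot_rot (R : SO3) (u v : S2) : dot (rot R u) (rot R v) = dot u v :=
  mulVec_dot_mulVec R _ _

theorem rot_mul (R T : SO3) (u : S2) : rot (R * T) u = rot R (rot T u) := by
  apply Subtype.ext
  apply WithLp.ofLp_injective
  simp [rot_ofLp, Matrix.mulVec_mulVec]

theorem rot_one (u : S2) : rot 1 u = u := by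
  apply Subtype.ext
  apply WithLp.ofLp_injective
  simp [rot_ofLp]

theorem rot_inv_rot (R : SO3) (u : S2) : rot R⁻¹ (rot R u) = u := by
  rw [← rot_mul, inv_mul_cancel, rot_one]

theorem rot_rot_inv (R : SO3) (u : S2) : rot R (rot R⁻¹ u) = u := by
  rw [← rot_mul, mul_inv_cancel, rot_one]

theorem dot_rot_left (R : SO3) (u v : S2) : dot (rot R u) v = dot u (rot R⁻¹ v) := by
  rw [← dot_rot_rot R u, rot_rot_inv]

theorem continuous_coord (i : Fin 3) : Continuous fun u : S2 => u.1 i := by fun_prop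

theorem continuous_dot : Continuous fun p : S2 × S2 => dot p.1 p.2 := by
  simp only [dot_eq]; fun_prop

theorem continuous_rot : Continuous fun p : SO3 × S2 => rot p.1 p.2 := by
  refine Continuous.subtype_mk ?_ _
  refine (PiLp.continuous_toLp 2 _).comp ?_
  refine Continuous.matrix_mulVec (continuous_subtype_val.comp continuous_fst) ?_
  exact (PiLp.continuous_ofLp 2 _).comp (continuous_subtype_val.comp continuous_snd)

/-- Rotation about the `z` axis. -/
noncomputable def rotZ (t : ℝ) : SO3 :=
  ⟨!![Real.cos t, -Real.sin t, 0; Real.sin t, Real.cos t, 0; 0, 0, 1], by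
    rw [Matrix.mem_specialOrthogonalGroup_iff, Matrix.mem_orthogonalGroup_iff]
    have := Real.sin_sq_add_cos_sq t
    constructor
    · ext i j
      fin_cases i <;> fin_cases j <;>
        simp [Matrix.mul_apply, Fin.sum_univ_three] <;> linarith
    · simp [Matrix.det_fin_three]; linarith⟩

/-- Rotation about the `y` axis. -/
noncomputable def rotY (t : ℝ) : SO3 :=
  ⟨!![Real.cos t, 0, Real.sin t; 0, 1, 0; -Real.sin t, 0, Real.cos t], by
    rw [Matrix.mem_specialOrthogonalGroup_iff, Matrix.mem_orthogonalGroup_iff]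
    have := Real.sin_sq_add_cos_sq t
    constructor
    · ext i j
      fin_cases i <;> fin_cases j <;>
        simp [Matrix.mul_apply, Fin.sum_univ_three] <;> linarith
    · simp [Matrix.det_fin_three]; linarith⟩

section coordinates

variable (t : ℝ) (u : S2)

theorem rotZ_zero : (rot (rotZ t) u).1 0 = Real.cos t * u.1 0 - Real.sin t * u.1 1 := by
  simp [rot_ofLp, rotZ, Matrix.mulVec, dotProduct, Fin.sum_univ_three]; ring

theorem rotZ_one : (rot (rotZ t) u).1 1 = Real.sin t * u.1 0 + Real.cos t * u.1 1 := by
  simp [rot_ofLp, rotZ, Matrix.mulVec, dotProduct, Fin.sum_univ_three]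

theorem rotZ_two : (rot (rotZ t) u).1 2 = u.1 2 := by
  simp [rot_ofLp, rotZ, Matrix.mulVec, dotProduct, Fin.sum_univ_three]

theorem rotY_zero : (rot (rotY t) u).1 0 = Real.cos t * u.1 0 + Real.sin t * u.1 2 := by
  simp [rot_ofLp, rotY, Matrix.mulVec, dotProduct, Fin.sum_univ_three]

theorem rotY_one : (rot (rotY t) u).1 1 = u.1 1 := by
  simp [rot_ofLp, rotY, Matrix.mulVec, dotProduct, Fin.sum_univ_three]

theorem rotY_two : (rot (rotY t) u).1 2 = -Real.sin t * u.1 0 + Real.cos t * u.1 2 := by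
  simp [rot_ofLp, rotY, Matrix.mulVec, dotProduct, Fin.sum_univ_three]

end coordinates

theorem rotZ_add (s t : ℝ) (u : S2) : rot (rotZ (s + t)) u = rot (rotZ s) (rot (rotZ t) u) := by
  apply ext_S2 <;> simp only [rotZ_zero, rotZ_one, rotZ_two, Real.cos_add, Real.sin_add] <;> ring

theorem rotZ_periodic (u : S2) : Function.Periodic (fun t => rot (rotZ t) u) (2 * Real.pi) := by
  intro t
  apply ext_S2 <;> simp only [rotZ_zero, rotZ_one, rotZ_two, Real.cos_add_two_pi,
    Real.sin_add_two_pi]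

theorem continuous_rotZ : Continuous rotZ := by
  refine Continuous.subtype_mk ?_ _
  refine continuous_matrix fun i j => ?_
  fin_cases i <;> fin_cases j <;> simp <;> fun_prop

/-- Two plane vectors of the same length differ by a rotation. -/
theorem exists_angle (x y : ℝ) : ∃ t : ℝ,
    x = Real.sqrt (x ^ 2 + y ^ 2) * Real.cos t ∧ y = Real.sqrt (x ^ 2 + y ^ 2) * Real.sin t := by
  have hn : ‖(⟨x, y⟩ : ℂ)‖ = Real.sqrt (x ^ 2 + y ^ 2) := by
    rw [Complex.norm_eq_sqrt_sq_add_sq]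
  refine ⟨Complex.arg ⟨x, y⟩, ?_, ?_⟩
  · rw [← hn, Complex.norm_mul_cos_arg]
  · rw [← hn, Complex.norm_mul_sin_arg]

/-- The point at height `z` on the meridian `y = 0`, `x ≥ 0`. -/
noncomputable def meridian (z : Set.Icc (-1 : ℝ) 1) : S2 :=
  mkS2 (Real.sqrt (1 - z.1 ^ 2)) 0 z.1 (by
    rw [Real.sq_sqrt (by nlinarith [z.2.1, z.2.2])]; ring)

theorem height_mem (u : S2) : u.1 2 ∈ Set.Icc (-1 : ℝ) 1 := by
  rw [← dot_pole]; exact abs_le.1 (abs_dot_le_one _ _)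

theorem exists_rotZ_meridian (u : S2) : ∃ t, u = rot (rotZ t) (meridian ⟨u.1 2, height_mem u⟩) := by
  obtain ⟨t, h0, h1⟩ := exists_angle (u.1 0) (u.1 1)
  have h : u.1 0 ^ 2 + u.1 1 ^ 2 = 1 - u.1 2 ^ 2 := by linarith [sq_add_sq_add_sq u]
  rw [h] at h0 h1
  refine ⟨t, ?_⟩
  apply ext_S2
  · rw [rotZ_zero, h0]; simp [meridian, mkS2]; ring
  · rw [rotZ_one, h1]; simp [meridian, mkS2]; ring
  · rw [rotZ_two]; simp [meridian, mkS2]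

theorem exists_rotY_pole (z : Set.Icc (-1 : ℝ) 1) : ∃ t, meridian z = rot (rotY t) pole := by
  obtain ⟨t, h0, h1⟩ := exists_angle z.1 (Real.sqrt (1 - z.1 ^ 2))
  have h : z.1 ^ 2 + Real.sqrt (1 - z.1 ^ 2) ^ 2 = 1 := by
    rw [Real.sq_sqrt (by nlinarith [z.2.1, z.2.2])]; ring
  rw [h, Real.sqrt_one, one_mul] at h0 h1
  refine ⟨t, ?_⟩
  apply ext_S2
  · rw [rotY_zero, ← h1]; simp [meridian, mkS2, pole]
  · rw [rotY_one]; simp [meridian, mkS2, pole]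
  · rw [rotY_two, ← h0]; simp [meridian, mkS2, pole]

/-- Every point of the sphere is obtained from the pole by a rotation about `y` followed by one
about `z`. -/
theorem exists_euler (u : S2) : ∃ s t, u = rot (rotZ s) (rot (rotY t) pole) := by
  obtain ⟨s, hs⟩ := exists_rotZ_meridian u
  obtain ⟨t, ht⟩ := exists_rotY_pole ⟨u.1 2, height_mem u⟩
  exact ⟨s, t, ht ▸ hs⟩

theorem exists_rot_pole (u : S2) : ∃ R : SO3, rot R pole = u := by
  obtain ⟨s, t, h⟩ := exists_euler u
  exact ⟨rotZ s * rotY t, by rw [rot_mul, h]⟩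

theorem exists_rot (u v : S2) : ∃ R : SO3, rot R u = v := by
  obtain ⟨R, rfl⟩ := exists_rot_pole u
  obtain ⟨T, rfl⟩ := exists_rot_pole v
  exact ⟨T * R⁻¹, by rw [rot_mul, rot_inv_rot]⟩

/-! ### The surface measure -/

/-- The surface measure of the sphere. -/
noncomputable abbrev area : Measure S2 := (volume : Measure E3).toSphere

/-- A rotation as a linear isometry of three-dimensional space. -/
noncomputable def SO3.isometry (R : SO3) : E3 ≃ₗᵢ[ℝ] E3 :=
  LinearIsometry.toLinearIsometryEquiv
    { toLinearMap := Matrix.toEuclideanLin R.1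
      norm_map' := fun x => by
        rw [EuclideanSpace.norm_eq, EuclideanSpace.norm_eq]
        congr 1
        have := mulVec_dot_mulVec R x.ofLp x.ofLp
        simpa [dotProduct, pow_two, Matrix.toEuclideanLin] using this } rfl

theorem SO3.isometry_apply (R : SO3) (u : S2) : R.isometry u = (rot R u).1 := rfl

-- The surface measure of a set is a multiple of the volume of the cone over it, and a rotation is a
-- volume-preserving isometry carrying cones to cones.
open scoped Pointwise in
theorem measurePreserving_rot (R : SO3) : MeasurePreserving (rot R) area area := by
  have hc : Continuous (rot R) := continuous_rot.comp (by fun_prop : Continuous fun u => (R, u))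
  refine ⟨hc.measurable, ?_⟩
  ext s hs
  rw [Measure.map_apply hc.measurable hs, Measure.toSphere_apply' _ hs,
    Measure.toSphere_apply' _ (hc.measurable hs)]
  congr 1
  rw [← R.isometry.measurePreserving.measure_preimage_emb
    R.isometry.toHomeomorph.measurableEmbedding (Set.Ioo (0 : ℝ) 1 • (Subtype.val '' s))]
  congr 1
  ext x
  simp only [Set.mem_smul, Set.mem_image, Set.mem_preimage]
  constructor
  · rintro ⟨r, hr, _, ⟨u, hu, rfl⟩, rfl⟩
    exact ⟨r, hr, _, ⟨rot R u, hu, rfl⟩, by rw [map_smul, R.isometry_apply]⟩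
  · rintro ⟨r, hr, _, ⟨u, hu, rfl⟩, h⟩
    refine ⟨r, hr, _, ⟨rot R⁻¹ u, by rwa [rot_rot_inv], rfl⟩, ?_⟩
    apply R.isometry.injective
    rw [← h, map_smul, R.isometry_apply, rot_rot_inv]

theorem integral_rot {E : Type*} [NormedAddCommGroup E] [NormedSpace ℝ E] (R : SO3) (g : S2 → E) :
    ∫ u, g (rot R u) ∂area = ∫ u, g u ∂area := by
  have hc (R : SO3) : Continuous (rot R) :=
    continuous_rot.comp (by fun_prop : Continuous fun u => (R, u))
  let e : S2 ≃ₜ S2 := ⟨⟨rot R, rot R⁻¹, rot_inv_rot R, rot_rot_inv R⟩, hc R, hc R⁻¹⟩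
  exact (measurePreserving_rot R).integral_comp e.measurableEmbedding g

theorem area_univ : area.real Set.univ = 4 * Real.pi := by
  rw [Measure.toSphere_real_apply_univ, measureReal_def, EuclideanSpace.volume_ball_fin_three]
  have h : (ENNReal.ofReal (Real.pi * 4 / 3)).toReal = Real.pi * 4 / 3 :=
    ENNReal.toReal_ofReal (by positivity)
  simp [h]
  ring

theorem integrable_of_continuous {E : Type*} [NormedAddCommGroup E] {g : S2 → E}
    (hg : Continuous g) : Integrable g area :=
  hg.integrable_of_hasCompactSupport (HasCompactSupport.of_compactSpace g)

/-! ### Legendre polynomials -/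

/-- The Legendre differential equation for `(X² - 1)^l`, differentiated `k` times. -/
theorem rodrigues_ode (l k : ℕ) :
    (X ^ 2 - 1) * derivative^[k + 2] ((X ^ 2 - 1 : ℝ[X]) ^ l)
      + 2 * ((k : ℝ[X]) + 1 - (l : ℝ[X])) * X * derivative^[k + 1] ((X ^ 2 - 1 : ℝ[X]) ^ l)
      + ((k : ℝ[X]) + 1) * ((k : ℝ[X]) - 2 * (l : ℝ[X])) *
        derivative^[k] ((X ^ 2 - 1 : ℝ[X]) ^ l) = 0 := by
  -- Differentiating this first-order equation once gives the case k = 0; each further derivative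
  -- raises k by one.
  have base : (X ^ 2 - 1) * derivative ((X ^ 2 - 1 : ℝ[X]) ^ l)
      = 2 * (l : ℝ[X]) * X * (X ^ 2 - 1 : ℝ[X]) ^ l := by
    cases l with
    | zero => simp
    | succ l =>
      rw [derivative_pow]
      simp only [derivative_sub, derivative_X_pow, derivative_one, C_eq_natCast]
      push_cast
      simp
      ring
  induction k with
  | zero =>
    have h := congrArg derivative base
    simp only [derivative_mul, derivative_sub, derivative_X_pow, derivative_one, derivative_X,
      derivative_natCast, derivative_ofNat, C_eq_natCast] at h
    simp only [Function.iterate_succ_apply', Function.iterate_zero_apply]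
    push_cast at h ⊢
    linear_combination h
  | succ k ih =>
    have h := congrArg derivative ih
    simp only [derivative_mul, derivative_add, derivative_sub, derivative_X_pow, derivative_one,
      derivative_X, derivative_natCast, derivative_ofNat, C_eq_natCast, derivative_zero,
      ← Function.iterate_succ_apply' derivative] at h
    push_cast at h ⊢
    linear_combination h

/-- The `m`-th derivative of the Legendre polynomial `P_l`. -/
noncomputable def legendreDeriv (l m : ℕ) : ℝ[X] := derivative^[m] (legendre l)

theorem legendreDeriv_eq (l m : ℕ) : legendreDeriv l m =
    C (1 / (2 ^ l * (l.factorial : ℝ))) * derivative^[m + l] ((X ^ 2 - 1) ^ l) := by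
  rw [legendreDeriv, legendre, iterate_derivative_C_mul, Function.iterate_add_apply]

theorem derivative_legendreDeriv (l m : ℕ) :
    derivative (legendreDeriv l m) = legendreDeriv l (m + 1) := by
  rw [legendreDeriv, legendreDeriv, Function.iterate_succ_apply']

theorem legendreDeriv_ode (l m : ℕ) (x : ℝ) :
    (1 - x ^ 2) * (legendreDeriv l (m + 2)).eval x
      - 2 * ((m : ℝ) + 1) * x * (legendreDeriv l (m + 1)).eval x
      + ((l : ℝ) + m + 1) * (l - m) * (legendreDeriv l m).eval x = 0 := by
  have h := congrArg (fun p => (C (1 / (2 ^ l * (l.factorial : ℝ))) * p).eval x)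
    (rodrigues_ode l (m + l))
  simp only [legendreDeriv_eq, eval_mul, eval_add, eval_sub, eval_pow, eval_X, eval_one, eval_C,
    eval_natCast, eval_ofNat, eval_zero] at h ⊢
  push_cast at h
  rw [show m + 2 + l = m + l + 2 by ring, show m + 1 + l = m + l + 1 by ring]
  linear_combination -h

theorem natDegree_rodrigues (l : ℕ) : ((X ^ 2 - 1 : ℝ[X]) ^ l).natDegree = 2 * l := by
  rw [natDegree_pow, show (X ^ 2 - 1 : ℝ[X]) = X ^ 2 - C 1 by simp, natDegree_X_pow_sub_C, mul_comm]

theorem monic_rodrigues (l : ℕ) : ((X ^ 2 - 1 : ℝ[X]) ^ l).Monic := by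
  rw [show (X ^ 2 - 1 : ℝ[X]) = X ^ 2 - C 1 by simp]
  exact (monic_X_pow_sub_C _ two_ne_zero).pow l

theorem legendreDeriv_succ_self (l : ℕ) : legendreDeriv l (l + 1) = 0 := by
  rw [legendreDeriv_eq, iterate_derivative_eq_zero, mul_zero]
  rw [natDegree_rodrigues]; omega

theorem degree_legendre (l : ℕ) : (legendre l).degree = l := by
  have hc : (1 / (2 ^ l * (l.factorial : ℝ))) ≠ 0 := by positivity
  rw [legendre, degree_C_mul hc]
  apply le_antisymm
  · refine degree_le_of_natDegree_le ((natDegree_iterate_derivative _ _).trans ?_)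
    rw [natDegree_rodrigues]; omega
  · apply le_degree_of_ne_zero
    rw [coeff_iterate_derivative]
    have h := (monic_rodrigues l).coeff_natDegree
    rw [natDegree_rodrigues, two_mul] at h
    rw [h, nsmul_eq_mul, mul_one]
    exact_mod_cast (Nat.descFactorial_pos.2 (by omega)).ne'

theorem legendre_eval_one (l : ℕ) : (legendre l).eval 1 = 1 := by
  have h : (X ^ 2 - 1 : ℝ[X]) ^ l = (X - C 1) ^ l * (X + C 1) ^ l := by
    rw [← mul_pow]; congr 1; simp; ring
  have hs : (derivative^[l] ((X ^ 2 - 1 : ℝ[X]) ^ l)).eval 1 = l.factorial * 2 ^ l := by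
    -- In the Leibniz expansion only the term with all l derivatives on (X - 1)^l survives at 1.
    rw [h, iterate_derivative_mul, eval_finsetSum, Finset.sum_eq_single 0]
    · rw [show (X - C 1 : ℝ[X]) = X + C (-1) by simp [sub_eq_add_neg], tsub_zero,
        iterate_derivative_X_add_pow]
      simp [Nat.descFactorial_self]
      norm_num
    · intro k hk hk0
      rw [show (X - C 1 : ℝ[X]) = X + C (-1) by simp [sub_eq_add_neg],
        iterate_derivative_X_add_pow]
      have : l - (l - k) ≠ 0 := by
        have := Finset.mem_range.1 hk; omega
      simp [this]
    · simp
  rw [legendre, eval_mul, eval_C, hs]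
  have : (l.factorial : ℝ) ≠ 0 := by positivity
  field_simp

theorem legendre_zero : legendre 0 = 1 := by simp [legendre]

/-- The Legendre polynomials as a sequence of polynomials of every degree. -/
noncomputable def legendreSequence : Polynomial.Sequence ℝ := ⟨legendre, degree_legendre⟩

/-- One polynomial in each degree, over a field, spans. Identities linear in a polynomial may thus
be checked on the P_l. -/
theorem mem_span_legendre (p : ℝ[X]) : p ∈ Submodule.span ℝ (Set.range legendre) := by
  have h := legendreSequence.span fun i =>
    (leadingCoeff_ne_zero.2 (legendreSequence.ne_zero i)).isUnit
  exact h.ge (Submodule.mem_top : p ∈ ⊤)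

/-! ### The addition theorem -/

/-- The complex coordinate `x + i y` of a point of the sphere. -/
noncomputable def planar (u : S2) : ℂ := ((u.1 0 : ℝ) : ℂ) + ((u.1 1 : ℝ) : ℂ) * Complex.I

/-- The unnormalized spherical harmonic of order `m ≥ 0`. -/
noncomputable def solid (l m : ℕ) (u : S2) : ℂ :=
  (((legendreDeriv l m).eval (u.1 2) : ℝ) : ℂ) * planar u ^ m

/-- The weight `(l - m)! / (l + m)!`. -/
noncomputable def weight (l m : ℕ) : ℝ := ((l - m).factorial : ℝ) / ((l + m).factorial : ℝ)

theorem weight_nonneg (l m : ℕ) : 0 ≤ weight l m := by unfold weight; positivity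

theorem weight_zero (l : ℕ) : weight l 0 = 1 := by
  rw [weight, Nat.sub_zero, Nat.add_zero]
  exact div_self (Nat.cast_ne_zero.2 l.factorial_ne_zero)

theorem solid_zero (l : ℕ) (u : S2) : solid l 0 u = (((legendre l).eval (u.1 2) : ℝ) : ℂ) := by
  simp [solid, legendreDeriv]

/-- The weights absorb the ladder factor (l + m + 1)(l - m), which makes the derivative of the
kernel telescope. -/
theorem weight_succ {l m : ℕ} (h : m < l) :
    weight l (m + 1) * ((l : ℝ) + m + 1) * (l - m) = weight l m := by
  obtain ⟨k, rfl⟩ := Nat.exists_eq_add_of_lt h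
  rw [weight, weight, show m + k + 1 - (m + 1) = k by omega, show m + k + 1 - m = k + 1 by omega,
    show m + k + 1 + (m + 1) = (m + k + 1 + m) + 1 by omega, Nat.factorial_succ (m + k + 1 + m),
    Nat.factorial_succ k]
  have h1 : ((m + k + 1 + m).factorial : ℝ) ≠ 0 := by positivity
  have h2 : ((m : ℝ) + k + 1 + m + 1) ≠ 0 := by positivity
  push_cast
  field_simp
  ring

/-- The reproducing kernel built from the harmonics of degree `l`. -/
noncomputable def kernel (l : ℕ) (u v : S2) : ℝ :=
  (legendre l).eval (u.1 2) * (legendre l).eval (v.1 2) +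
    ∑ m ∈ Finset.range l, 2 * weight l (m + 1) * (solid l (m + 1) u * conj (solid l (m + 1) v)).re

theorem planar_rotZ (t : ℝ) (u : S2) :
    planar (rot (rotZ t) u) = Complex.exp (t * Complex.I) * planar u := by
  rw [Complex.exp_mul_I, ← Complex.ofReal_cos, ← Complex.ofReal_sin, planar, planar, rotZ_zero,
    rotZ_one]
  push_cast
  linear_combination -(Complex.sin t * ((u.1 1 : ℝ) : ℂ)) * Complex.I_sq

theorem solid_rotZ (l m : ℕ) (t : ℝ) (u : S2) :
    solid l m (rot (rotZ t) u) = Complex.exp (t * Complex.I) ^ m * solid l m u := by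
  rw [solid, solid, planar_rotZ, rotZ_two, mul_pow]; ring

theorem kernel_rotZ (l : ℕ) (t : ℝ) (u v : S2) :
    kernel l (rot (rotZ t) u) (rot (rotZ t) v) = kernel l u v := by
  have h : Complex.exp (t * Complex.I) * conj (Complex.exp (t * Complex.I)) = 1 := by
    rw [Complex.mul_conj, Complex.normSq_eq_norm_sq, Complex.norm_exp_ofReal_mul_I]; simp
  simp only [kernel, rotZ_two]
  congr 1
  refine Finset.sum_congr rfl fun m _ => ?_
  congr 2
  rw [solid_rotZ, solid_rotZ, map_mul, map_pow, mul_mul_mul_comm, ← mul_pow, h, one_pow, one_mul]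

theorem hasDerivAt_rotY_zero (t : ℝ) (u : S2) :
    HasDerivAt (F := ℝ) (fun t => (rot (rotY t) u).1 0) ((rot (rotY t) u).1 2) t := by
  simp only [rotY_zero, rotY_two]
  exact ((Real.hasDerivAt_cos t).mul_const _).add ((Real.hasDerivAt_sin t).mul_const _)

theorem hasDerivAt_rotY_two (t : ℝ) (u : S2) :
    HasDerivAt (F := ℝ) (fun t => (rot (rotY t) u).1 2) (-(rot (rotY t) u).1 0) t := by
  simp only [rotY_zero, rotY_two]
  refine (((Real.hasDerivAt_sin t).neg.mul_const (u.1 0)).add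
    ((Real.hasDerivAt_cos t).mul_const (u.1 2))).congr_deriv ?_
  ring

theorem hasDerivAt_planar (t : ℝ) (u : S2) :
    HasDerivAt (fun t => planar (rot (rotY t) u)) (((rot (rotY t) u).1 2 : ℝ) : ℂ) t := by
  simp only [planar, rotY_one]
  exact (hasDerivAt_rotY_zero t u).ofReal_comp.add_const _

theorem planar_mul_conj (u : S2) : planar u * conj (planar u) = ((1 - u.1 2 ^ 2 : ℝ) : ℂ) := by
  rw [Complex.mul_conj, planar, Complex.normSq_add_mul_I]
  congr 1
  linarith [sq_add_sq_add_sq u]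

theorem planar_add_conj (u : S2) : planar u + conj (planar u) = ((2 * u.1 0 : ℝ) : ℂ) := by
  rw [Complex.add_conj]; simp [planar]

theorem hasDerivAt_legendreDeriv_rotY (l m : ℕ) (t : ℝ) (u : S2) :
    HasDerivAt (F := ℝ) (fun t => (legendreDeriv l m).eval ((rot (rotY t) u).1 2))
      ((legendreDeriv l (m + 1)).eval ((rot (rotY t) u).1 2) * -(rot (rotY t) u).1 0) t := by
  rw [← derivative_legendreDeriv]
  exact ((legendreDeriv l m).hasDerivAt _).comp t (hasDerivAt_rotY_two t u)

theorem hasDerivAt_legendre_rotY (l : ℕ) (t : ℝ) (u : S2) :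
    HasDerivAt (F := ℝ) (fun t => (legendre l).eval ((rot (rotY t) u).1 2))
      (-(solid l 1 (rot (rotY t) u)).re) t := by
  refine (hasDerivAt_legendreDeriv_rotY l 0 t u).congr_deriv ?_
  simp [solid, planar]

/-- The ladder relation: the derivative of a harmonic along rotations about the `y` axis. -/
theorem hasDerivAt_solid_rotY (l m : ℕ) (t : ℝ) (u : S2) :
    HasDerivAt (fun t => solid l (m + 1) (rot (rotY t) u))
      (-(1 / 2) * solid l (m + 2) (rot (rotY t) u)
        + 1 / 2 * (((l : ℝ) + m + 1) * (l - m) : ℝ) * solid l m (rot (rotY t) u)) t := by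
  have h := (hasDerivAt_legendreDeriv_rotY l (m + 1) t u).ofReal_comp.mul
    ((hasDerivAt_planar t u).pow (m + 1))
  refine h.congr_deriv ?_
  set v := rot (rotY t) u
  have ode := congrArg (fun r : ℝ => (r : ℂ)) (legendreDeriv_ode l m (v.1 2))
  have h1 := planar_mul_conj v
  have h2 := planar_add_conj v
  simp only [solid, Pi.pow_apply]
  rw [show planar (rot (rotY t) u) = planar v from rfl]
  push_cast at ode h1 h2 ⊢
  generalize (planar v) = w at *
  generalize conj w = w' at *
  generalize ((v.1 2 : ℝ) : ℂ) = z at *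
  generalize ((v.1 0 : ℝ) : ℂ) = x at *
  have hx : x = (w + w') / 2 := by rw [h2]; ring
  rw [hx]
  -- With x = (w + w')/2, the w part gives order m + 2. In the w' part w w' = 1 - z², and the
  -- Legendre equation turns it, together with the derivative of the power of w, into order m.
  linear_combination -(1 / 2 : ℂ) * w ^ m * ode -
    (1 / 2 : ℂ) * w ^ m * (((legendreDeriv l (m + 2)).eval (v.1 2) : ℝ) : ℂ) * h1

/-- The telescoping term in the derivative of the kernel along rotations about the `y` axis. -/
noncomputable def ladderTerm (l m : ℕ) (u v : S2) : ℝ :=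
  weight l m * (solid l (m + 1) u * conj (solid l m v)
    + solid l m u * conj (solid l (m + 1) v)).re

/-- The order-lowering halves of the ladder relation give the first ladder term, the order-raising
halves the second. -/
theorem hasDerivAt_kernel_term {l m : ℕ} (hm : m < l) (t : ℝ) (u v : S2) :
    HasDerivAt (fun t => 2 * weight l (m + 1) * (solid l (m + 1) (rot (rotY t) u) *
        conj (solid l (m + 1) (rot (rotY t) v))).re)
      (ladderTerm l m (rot (rotY t) u) (rot (rotY t) v)
        - ladderTerm l (m + 1) (rot (rotY t) u) (rot (rotY t) v)) t := by
  have h := (hasDerivAt_solid_rotY l m t u).mul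
    (Complex.conjCLE.hasFDerivAt.comp_hasDerivAt t (hasDerivAt_solid_rotY l m t v))
  have h' := ((Complex.reCLM.hasFDerivAt.comp_hasDerivAt t h).const_mul (2 * weight l (m + 1)))
  refine h'.congr_deriv ?_
  rw [ladderTerm, ladderTerm, ← weight_succ hm]
  simp [Complex.reCLM_apply]
  ring

/-- The t-derivative vanishes: the sum telescopes to the ladder terms at 0 and l. The former cancels
the derivative of P_l(u_z) P_l(v_z); the latter is 0 since P_l has degree l. -/
theorem kernel_rotY (l : ℕ) (t : ℝ) (u v : S2) :
    kernel l (rot (rotY t) u) (rot (rotY t) v) = kernel l u v := by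
  have hd (t : ℝ) : HasDerivAt (fun t => kernel l (rot (rotY t) u) (rot (rotY t) v)) 0 t := by
    have h := (HasDerivAt.add (F := ℝ) ((hasDerivAt_legendre_rotY l t u).mul
      (hasDerivAt_legendre_rotY l t v))
      (HasDerivAt.fun_sum fun m (hm : m ∈ Finset.range l) =>
        hasDerivAt_kernel_term (Finset.mem_range.1 hm) t u v))
    refine h.congr_deriv ?_
    rw [Finset.sum_range_sub']
    have hl (w : S2) : solid l (l + 1) w = 0 := by simp [solid, legendreDeriv_succ_self]
    simp [ladderTerm, hl, weight_zero, solid_zero]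
    ring
  have h0 (w : S2) : rot (rotY 0) w = w := by
    apply ext_S2 <;> simp [rotY_zero, rotY_one, rotY_two]
  have h := is_const_of_deriv_eq_zero (fun t => (hd t).differentiableAt) (fun t => (hd t).deriv) t 0
  simpa [h0] using h

theorem kernel_pole (l : ℕ) (u : S2) : kernel l u pole = (legendre l).eval (u.1 2) := by
  have h (m : ℕ) : solid l (m + 1) pole = 0 := by simp [solid, planar, pole, mkS2]
  simp only [kernel, h, map_zero, mul_zero, Complex.zero_re, Finset.sum_const_zero, add_zero]
  simp [pole, mkS2, legendre_eval_one]

/-- The addition theorem for spherical harmonics. -/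
theorem kernel_eq (l : ℕ) (u v : S2) : kernel l u v = (legendre l).eval (dot u v) := by
  obtain ⟨s, t, rfl⟩ := exists_euler v
  -- Both sides are invariant under the two Euler rotations, which reduces `v` to the pole.
  have hu : u = rot (rotZ s) (rot (rotY t) (rot (rotY t)⁻¹ (rot (rotZ s)⁻¹ u))) := by
    rw [rot_rot_inv, rot_rot_inv]
  rw [hu, kernel_rotZ, kernel_rotY, dot_rot_rot, dot_rot_rot, dot_pole, kernel_pole]

/-! ### Spherical harmonics -/

theorem sum_Icc_neg {M : Type*} [AddCommMonoid M] (g : ℤ → M) (l : ℕ) :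
    ∑ m ∈ Finset.Icc (-(l : ℤ)) l, g m =
      g 0 + ∑ m ∈ Finset.range l, (g (m + 1 : ℕ) + g (-(m + 1 : ℕ))) := by
  induction l with
  | zero => simp
  | succ l ih =>
    rw [Finset.sum_range_succ, ← add_assoc, ← ih]
    push_cast
    rw [show Finset.Icc (-((l : ℤ) + 1)) (l + 1) =
      insert ((l : ℤ) + 1) (insert (-((l : ℤ) + 1)) (Finset.Icc (-(l : ℤ)) l)) by
        ext m; simp only [Finset.mem_insert, Finset.mem_Icc]; omega,
      Finset.sum_insert, Finset.sum_insert]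
    · abel
    · simp
    · simp only [Finset.mem_insert, Finset.mem_Icc]; omega

theorem sphericalHarmonic_natCast (l m : ℕ) (u : S2) :
    sphericalHarmonic l (m : ℤ) u =
      (Real.sqrt ((2 * l + 1) / (4 * Real.pi) * weight l m) : ℂ) * (-1) ^ m * solid l m u := by
  rw [sphericalHarmonic, if_pos (by positivity), sphericalHarmonicNonneg, solid, weight, planar,
    legendreDeriv]
  simp only [Int.natAbs_natCast]
  ring

theorem sphericalHarmonic_neg (l m : ℕ) (u : S2) :
    sphericalHarmonic l (-(m + 1 : ℕ)) u =
      (-1) ^ (m + 1) * conj (sphericalHarmonic l ((m + 1 : ℕ) : ℤ) u) := by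
  rw [sphericalHarmonic, if_neg (by omega), sphericalHarmonic, if_pos (by positivity)]
  simp only [Int.natAbs_natCast, Int.natAbs_neg]

theorem neg_one_pow_mul_conj (m : ℕ) : ((-1 : ℂ) ^ m) * conj ((-1 : ℂ) ^ m) = 1 := by
  rw [map_pow, map_neg, map_one, ← mul_pow]; simp

theorem sphericalHarmonic_mul_conj (l m : ℕ) (u v : S2) :
    sphericalHarmonic l (m : ℤ) u * conj (sphericalHarmonic l (m : ℤ) v) =
      (((2 * l + 1) / (4 * Real.pi) * weight l m : ℝ) : ℂ) * (solid l m u * conj (solid l m v)) := by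
  have h : (0 : ℝ) ≤ (2 * l + 1) / (4 * Real.pi) * weight l m :=
    mul_nonneg (by positivity) (weight_nonneg l m)
  rw [sphericalHarmonic_natCast, sphericalHarmonic_natCast, map_mul, map_mul, Complex.conj_ofReal]
  calc _ = ((Real.sqrt ((2 * l + 1) / (4 * Real.pi) * weight l m) : ℂ)
        * (Real.sqrt ((2 * l + 1) / (4 * Real.pi) * weight l m) : ℂ))
        * ((-1) ^ m * conj ((-1) ^ m)) * (solid l m u * conj (solid l m v)) := by ring
    _ = _ := by rw [neg_one_pow_mul_conj, ← Complex.ofReal_mul, Real.mul_self_sqrt h, mul_one]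

/-- The addition theorem for the normalized spherical harmonics. -/
theorem sum_sphericalHarmonic (l : ℕ) (u v : S2) :
    ∑ m ∈ Finset.Icc (-(l : ℤ)) l, sphericalHarmonic l m u * conj (sphericalHarmonic l m v) =
      (((2 * l + 1) / (4 * Real.pi) * (legendre l).eval (dot u v) : ℝ) : ℂ) := by
  rw [← kernel_eq, sum_Icc_neg, kernel, mul_add, Finset.mul_sum, Complex.ofReal_add,
    Complex.ofReal_sum]
  congr 1
  · have h := sphericalHarmonic_mul_conj l 0 u v
    rw [weight_zero, solid_zero, solid_zero, Complex.conj_ofReal] at h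
    rw [show (0 : ℤ) = ((0 : ℕ) : ℤ) from rfl, h]
    push_cast
    ring
  · refine Finset.sum_congr rfl fun m _ => ?_
    rw [sphericalHarmonic_neg, sphericalHarmonic_neg, map_mul, Complex.conj_conj]
    have h := sphericalHarmonic_mul_conj l (m + 1) u v
    have h' : conj (sphericalHarmonic l ((m + 1 : ℕ) : ℤ) u) *
        sphericalHarmonic l ((m + 1 : ℕ) : ℤ) v =
        (((2 * l + 1) / (4 * Real.pi) * weight l (m + 1) : ℝ) : ℂ) *
          conj (solid l (m + 1) u * conj (solid l (m + 1) v)) := by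
      rw [← Complex.conj_ofReal, ← map_mul, ← h, map_mul, Complex.conj_conj]
    rw [h, mul_mul_mul_comm, neg_one_pow_mul_conj, one_mul, h', ← mul_add, Complex.add_conj]
    push_cast
    ring

theorem continuous_planar : Continuous planar := by
  unfold planar; fun_prop

theorem continuous_solid (l m : ℕ) : Continuous (solid l m) := by
  have := continuous_planar
  unfold solid
  fun_prop

theorem continuous_sphericalHarmonic (l : ℕ) (m : ℤ) : Continuous (sphericalHarmonic l m) := by
  have h (k : ℕ) : Continuous (sphericalHarmonic l (k : ℤ)) := by
    have := continuous_solid l k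
    simp only [funext (sphericalHarmonic_natCast l k)]
    fun_prop
  obtain ⟨k, rfl | rfl⟩ := m.eq_nat_or_neg
  · exact h k
  · cases k with
    | zero => exact h 0
    | succ k =>
      rw [funext (sphericalHarmonic_neg l k)]
      exact continuous_const.mul (Complex.continuous_conj.comp (h (k + 1)))

theorem norm_const_ne_zero (l : ℕ) : (((2 * l + 1) / (4 * Real.pi) : ℝ) : ℂ) ≠ 0 := by
  have : ((2 * l + 1) / (4 * Real.pi) : ℝ) ≠ 0 := by positivity
  exact_mod_cast this

/-- A sum of squared moduli vanishes only termwise. This takes the place of linear independence of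
the harmonics in the two criteria below. -/
theorem eq_zero_of_sum_mul_conj {l : ℕ} {c : ℤ → ℂ}
    (h : ∑ m ∈ Finset.Icc (-(l : ℤ)) l, c m * conj (c m) = 0) :
    ∀ m ∈ Set.Icc (-(l : ℤ)) l, c m = 0 := by
  intro m hm
  simp only [Complex.mul_conj, ← Complex.ofReal_sum, Complex.ofReal_eq_zero] at h
  exact Complex.normSq_eq_zero.1 ((Finset.sum_eq_zero_iff_of_nonneg
    fun _ _ => Complex.normSq_nonneg _).1 h m (Finset.mem_Icc.2 hm))

/-- The sum condition says that the zonal harmonics of degree `l` sum to zero over the directions. -/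
theorem sumCondition_iff {N : ℕ} (n : Fin N → S2) (l : ℕ) :
    SumCondition n l ↔ ∀ x, ∑ j, (legendre l).eval (dot (n j) x) = 0 := by
  have key (x : S2) : (((2 * l + 1) / (4 * Real.pi) : ℝ) : ℂ) *
      ((∑ j, (legendre l).eval (dot (n j) x) : ℝ) : ℂ) = ∑ m ∈ Finset.Icc (-(l : ℤ)) l,
        (∑ j, sphericalHarmonic l m (n j)) * conj (sphericalHarmonic l m x) := by
    simp only [Finset.sum_mul]
    rw [Finset.sum_comm, Complex.ofReal_sum, Finset.mul_sum]
    refine Finset.sum_congr rfl fun j _ => ?_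
    rw [sum_sphericalHarmonic, Complex.ofReal_mul]
  constructor
  · intro h x
    have hx := (key x).trans
      (Finset.sum_eq_zero fun m hm => by rw [h m (Finset.mem_Icc.1 hm), zero_mul])
    exact_mod_cast (mul_eq_zero.1 hx).resolve_left (norm_const_ne_zero l)
  · intro h
    apply eq_zero_of_sum_mul_conj
    -- The sum of squared moduli is obtained by adding `key` over the points x = n_j.
    simp only [map_sum]
    simp only [Finset.mul_sum]
    rw [Finset.sum_comm]
    refine Finset.sum_eq_zero fun j _ => ?_
    rw [← key, h, Complex.ofReal_zero, mul_zero]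

/-- The zonal component of degree `l` of a function on the sphere. -/
noncomputable def zonal (F : S2 → ℝ) (l : ℕ) (y : S2) : ℝ :=
  ∫ u, (legendre l).eval (dot y u) * F u ∂area

theorem zonal_eq {F : S2 → ℝ} (hF : Continuous F) (l : ℕ) (y : S2) :
    (((2 * l + 1) / (4 * Real.pi) : ℝ) : ℂ) * (zonal F l y : ℂ) =
      ∑ m ∈ Finset.Icc (-(l : ℤ)) l, sphericalHarmonic l m y * harmonicCoeff F l m := by
  have hY := continuous_sphericalHarmonic l
  simp only [harmonicCoeff, ← integral_const_mul]
  rw [← integral_finsetSum]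
  · rw [zonal, ← integral_complex_ofReal, ← integral_const_mul]
    refine integral_congr_ae (.of_forall fun u => ?_)
    simp only [← mul_assoc, ← Finset.sum_mul, sum_sphericalHarmonic]
    push_cast
    ring
  · intro m _
    exact integrable_of_continuous (continuous_const.mul
      ((Complex.continuous_conj.comp (hY m)).mul (Complex.continuous_ofReal.comp hF)))

/-- The coefficients of degree `l` vanish exactly when the zonal component of degree `l` does. -/
theorem harmonicCoeff_eq_zero_iff {F : S2 → ℝ} (hF : Continuous F) (l : ℕ) :
    (∀ m ∈ Set.Icc (-(l : ℤ)) l, harmonicCoeff F l m = 0) ↔ ∀ y, zonal F l y = 0 := by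
  constructor
  · intro h y
    have hy := (zonal_eq hF l y).trans
      (Finset.sum_eq_zero fun m hm => by rw [h m (Finset.mem_Icc.1 hm), mul_zero])
    exact_mod_cast (mul_eq_zero.1 hy).resolve_left (norm_const_ne_zero l)
  · intro h
    have hY := continuous_sphericalHarmonic l
    apply eq_zero_of_sum_mul_conj
    -- Hence ∑_m |c_{lm}|² is a multiple of the integral of F times its zonal component.
    have hc (m : ℤ) : conj (harmonicCoeff F l m) =
        ∫ y, (F y : ℂ) * sphericalHarmonic l m y ∂area := by
      rw [harmonicCoeff, ← integral_conj]
      refine integral_congr_ae (.of_forall fun u => ?_)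
      simp [mul_comm]
    simp only [hc, ← integral_const_mul]
    rw [← integral_finsetSum]
    · rw [← integral_zero S2 ℂ (μ := area)]
      refine integral_congr_ae (.of_forall fun y => ?_)
      have hy := zonal_eq hF l y
      rw [h y, Complex.ofReal_zero, mul_zero] at hy
      calc _ = (F y : ℂ) * ∑ m ∈ Finset.Icc (-(l : ℤ)) l,
            sphericalHarmonic l m y * harmonicCoeff F l m := by
            rw [Finset.mul_sum]; exact Finset.sum_congr rfl fun m _ => by ring
        _ = 0 := by rw [← hy, mul_zero]
    · intro m _
      exact integrable_of_continuous (continuous_const.mul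
        ((Complex.continuous_ofReal.comp hF).mul (hY m)))

theorem harmonicCoeff_zero_zero (F : S2 → ℝ) :
    harmonicCoeff F 0 0 = ((∫ u, F u ∂area) / Real.sqrt (4 * Real.pi) : ℝ) := by
  have h (u : S2) : sphericalHarmonic 0 0 u = ((1 / Real.sqrt (4 * Real.pi) : ℝ) : ℂ) := by
    have := sphericalHarmonic_natCast 0 0 u
    rw [weight_zero, solid_zero, legendre_zero] at this
    simpa using this
  simp only [harmonicCoeff, h, Complex.conj_ofReal, ← Complex.ofReal_mul]
  rw [integral_complex_ofReal, integral_const_mul]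
  congr 1
  ring

theorem zonal_zero (F : S2 → ℝ) (y : S2) : zonal F 0 y = ∫ u, F u ∂area := by
  simp [zonal, legendre_zero]

/-! ### Integration against zonal harmonics -/

theorem integral_eq_zero_of_rotZ_neg {g : S2 → ℝ} (t : ℝ) (hg : ∀ u, g (rot (rotZ t) u) = -g u) :
    ∫ u, g u ∂area = 0 := by
  have h := integral_rot (rotZ t) g
  simp only [hg, integral_neg] at h
  linarith

/-- The Funk–Hecke formula for a function that is invariant under rotations about the `z` axis. -/
theorem integral_mul_legendre_of_rotZ_invariant {h : S2 → ℝ} (hc : Continuous h)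
    (hi : ∀ t u, h (rot (rotZ t) u) = h u) (l : ℕ) (x : S2) :
    ∫ u, h u * (legendre l).eval (dot u x) ∂area =
      (legendre l).eval (x.1 2) * ∫ u, h u * (legendre l).eval (u.1 2) ∂area := by
  have hs := continuous_solid l
  have hP : Continuous fun u : S2 => (legendre l).eval (u.1 2) :=
    (legendre l).continuous.comp (continuous_coord 2)
  have hterm (m : ℕ) : Continuous fun u => h u * (2 * weight l (m + 1) *
      (solid l (m + 1) u * conj (solid l (m + 1) x)).re) := by
    exact hc.mul (continuous_const.mul
      (Complex.continuous_re.comp ((hs (m + 1)).mul continuous_const)))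
  have hzero (m : ℕ) : ∫ u, h u * (2 * weight l (m + 1) *
      (solid l (m + 1) u * conj (solid l (m + 1) x)).re) ∂area = 0 := by
    -- Rotation by π/(m + 1) multiplies a harmonic of order m + 1 by -1.
    apply integral_eq_zero_of_rotZ_neg (Real.pi / (m + 1 : ℕ))
    intro u
    have he : Complex.exp ((Real.pi / (m + 1 : ℕ) : ℝ) * Complex.I) ^ (m + 1) = -1 := by
      rw [← Complex.exp_nat_mul, ← Complex.exp_pi_mul_I]
      congr 1
      have : ((m : ℂ) + 1) ≠ 0 := by exact_mod_cast m.succ_ne_zero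
      push_cast
      field_simp
    rw [hi, solid_rotZ, he]
    simp
    ring
  simp only [← kernel_eq, kernel, mul_add, Finset.mul_sum]
  rw [integral_add, integral_finsetSum, Finset.sum_eq_zero fun m _ => hzero m, add_zero,
    ← integral_const_mul]
  · refine integral_congr_ae (.of_forall fun u => ?_)
    simp only
    ring
  · exact fun m _ => integrable_of_continuous (hterm m)
  · exact integrable_of_continuous (by fun_prop)
  · exact integrable_of_continuous (continuous_finsetSum _ fun m _ => hterm m)

/-- The Funk–Hecke formula. -/
theorem integral_comp_dot_mul_legendre {z : ℝ → ℝ} (hz : Continuous z) (l : ℕ) (n x : S2) :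
    ∫ u, z (dot n u) * (legendre l).eval (dot u x) ∂area =
      (legendre l).eval (dot n x) * ∫ u, z (u.1 2) * (legendre l).eval (u.1 2) ∂area := by
  obtain ⟨R, rfl⟩ := exists_rot_pole n
  rw [← integral_rot R]
  simp only [dot_rot_left R, rot_inv_rot, dot_comm pole, dot_pole]
  exact integral_mul_legendre_of_rotZ_invariant (h := fun u => z (u.1 2))
    (hz.comp (continuous_coord 2)) (fun t u => by rw [rotZ_two]) l (rot R⁻¹ x)

/-- The integral of a zonal harmonic of positive degree vanishes. -/
theorem integral_legendre_dot {l : ℕ} (hl : 1 ≤ l) (x : S2) :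
    ∫ u, (legendre l).eval (dot u x) ∂area = 0 := by
  -- For constant z the left side of Funk–Hecke is independent of n. If it were nonzero, P_l would
  -- be constant on [-1, 1], against its degree.
  have key (n : S2) := integral_comp_dot_mul_legendre (z := fun _ => 1) continuous_const l n x
  simp only [one_mul] at key
  have hx := key x
  rw [dot_self, legendre_eval_one, one_mul] at hx
  rw [hx]
  by_contra hI
  have h1 (n : S2) : (legendre l).eval (dot n x) = 1 := by
    have := key n
    rw [hx] at this
    exact (mul_eq_right₀ hI).1 this.symm
  obtain ⟨R, rfl⟩ := exists_rot_pole x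
  have h2 (t : ℝ) (ht : t ∈ Set.Icc (-1 : ℝ) 1) : (legendre l).eval t = (1 : ℝ[X]).eval t := by
    rw [eval_one, ← h1 (rot R (meridian ⟨t, ht⟩)), dot_rot_rot, dot_pole]
    simp [meridian, mkS2]
  have h3 : legendre l = 1 := by
    refine Polynomial.eq_of_infinite_eval_eq _ _ ((Set.Icc_infinite (by norm_num)).mono h2)
  have h4 := degree_legendre l
  rw [h3, degree_one] at h4
  have : l = 0 := by exact_mod_cast h4.symm
  omega

/-! ### From the frame condition to the harmonics -/

/-- The integral of `F ∘ R` over the circle of the points at the height of `u`. -/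
noncomputable def axialIntegral (F : S2 → ℝ) (R : SO3) (u : S2) : ℝ :=
  ∫ t in (0 : ℝ)..2 * Real.pi, F (rot R (rot (rotZ t) u))

theorem continuous_rot_rotZ (R : SO3) : Continuous fun p : S2 × ℝ => rot R (rot (rotZ p.2) p.1) :=
  continuous_rot.comp (continuous_const.prodMk
    (continuous_rot.comp ((continuous_rotZ.comp continuous_snd).prodMk continuous_fst)))

theorem continuous_axialIntegral {F : S2 → ℝ} (hF : Continuous F) (R : SO3) :
    Continuous (axialIntegral F R) :=
  intervalIntegral.continuous_parametric_intervalIntegral_of_continuous'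
    (f := fun u t => F (rot R (rot (rotZ t) u))) (hF.comp (continuous_rot_rotZ R)) _ _

theorem axialIntegral_rotZ (F : S2 → ℝ) (R : SO3) (s : ℝ) (u : S2) :
    axialIntegral F R (rot (rotZ s) u) = axialIntegral F R u := by
  have hp : Function.Periodic (fun t => F (rot R (rot (rotZ t) u))) (2 * Real.pi) :=
    fun t => congrArg (fun v => F (rot R v)) (rotZ_periodic u t)
  have h := hp.intervalIntegral_add_eq s 0
  rw [zero_add] at h
  rw [axialIntegral, axialIntegral, ← h]
  simp only [← rotZ_add]
  rw [intervalIntegral.integral_comp_add_right (fun t => F (rot R (rot (rotZ t) u))), zero_add,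
    add_comm s]

/-- The average depends on the height alone, so it has the form z(u_z) required by Funk–Hecke. -/
theorem axialIntegral_eq (F : S2 → ℝ) (R : SO3) (u : S2) :
    axialIntegral F R u = axialIntegral F R (meridian ⟨u.1 2, height_mem u⟩) := by
  obtain ⟨t, ht⟩ := exists_rotZ_meridian u
  conv_lhs => rw [ht]
  rw [axialIntegral_rotZ]

/-- By Fubini; rotations about the axis fix P_l(u_z), so every angle contributes the same zonal
component. -/
theorem integral_axialIntegral_mul_legendre {F : S2 → ℝ} (hF : Continuous F) (R : SO3) (l : ℕ) :
    ∫ u, axialIntegral F R u * (legendre l).eval (u.1 2) ∂area =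
      2 * Real.pi * zonal F l (rot R pole) := by
  have hc : Continuous fun p : ℝ × S2 =>
      F (rot R (rot (rotZ p.1) p.2)) * (legendre l).eval (p.2.1 2) :=
    ((hF.comp (continuous_rot_rotZ R)).comp continuous_swap).mul
      ((legendre l).continuous.comp ((continuous_coord 2).comp continuous_snd))
  have hint : Integrable (Function.uncurry fun (t : ℝ) (u : S2) =>
      F (rot R (rot (rotZ t) u)) * (legendre l).eval (u.1 2))
      ((volume.restrict (Set.uIoc 0 (2 * Real.pi))).prod area) := by
    rw [← Measure.restrict_univ (μ := area), Measure.prod_restrict]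
    exact (hc.continuousOn.integrableOn_compact (isCompact_uIcc.prod isCompact_univ)).mono_set
      (Set.prod_mono Set.uIoc_subset_uIcc subset_rfl)
  have inner (t : ℝ) : ∫ u, F (rot R (rot (rotZ t) u)) * (legendre l).eval (u.1 2) ∂area =
      zonal F l (rot R pole) := by
    rw [zonal, ← integral_rot R fun u => _ * F u, ← integral_rot (rotZ t) fun u => _ * F (rot R u)]
    refine integral_congr_ae (.of_forall fun u => ?_)
    simp only
    rw [dot_rot_rot, dot_comm, dot_pole, rotZ_two, mul_comm]
  simp only [axialIntegral, ← intervalIntegral.integral_mul_const]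
  rw [← intervalIntegral_integral_swap hint]
  simp only [inner]
  simp

/-- If the values of `F` on all rotated copies of a family of directions sum to one, then its zonal
component of degree `l` and the zonal sums of the family determine each other. -/
theorem zonal_mul_sum_legendre {N : ℕ} {n : Fin N → S2} {F : S2 → ℝ} (hF : Continuous F)
    (h : ∀ R : SO3, ∑ j, F (rot R (n j)) = 1) (l : ℕ) (x y : S2) :
    zonal F l y * ∑ j, (legendre l).eval (dot (n j) x) =
      ∫ u, (legendre l).eval (dot u x) ∂area := by
  obtain ⟨R, rfl⟩ := exists_rot_pole y
  -- The projection onto [-1, 1] only serves to make z continuous on all of ℝ.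
  set z : ℝ → ℝ := fun t =>
    axialIntegral F R (meridian (Set.projIcc (-1) 1 (by norm_num) t)) with hzdef
  have hm : Continuous meridian := by
    refine Continuous.subtype_mk ((PiLp.continuous_toLp 2 _).comp ?_) _
    refine continuous_pi fun i => ?_
    fin_cases i <;> simp <;> fun_prop
  have hz : Continuous z :=
    (continuous_axialIntegral hF R).comp (hm.comp continuous_projIcc)
  have hzu (u : S2) : z (u.1 2) = axialIntegral F R u := by
    rw [hzdef, axialIntegral_eq]
    simp only [Set.projIcc_of_mem _ (height_mem u)]
  have hsum (w : S2) : ∑ j, z (dot (n j) w) = 2 * Real.pi := by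
    obtain ⟨T, rfl⟩ := exists_rot_pole w
    -- For each angle the points at which F is evaluated form one rotated copy of the family, so the
    -- integrands sum to 1.
    have hj (j : Fin N) : z (dot (n j) (rot T pole)) = axialIntegral F R (rot T⁻¹ (n j)) := by
      rw [dot_comm, dot_rot_left, dot_comm, dot_pole, hzu]
    simp only [hj, axialIntegral]
    rw [← intervalIntegral.integral_finsetSum]
    · have hone (t : ℝ) : ∑ j, F (rot R (rot (rotZ t) (rot T⁻¹ (n j)))) = 1 := by
        simp only [← rot_mul]
        exact h _
      simp [hone]
    · intro j _
      exact (hF.comp ((continuous_rot_rotZ R).comp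
        (continuous_const.prodMk continuous_id))).intervalIntegrable _ _
  have hd (w : S2) : Continuous fun u => dot w u :=
    continuous_dot.comp (continuous_const.prodMk continuous_id)
  have key : ∑ j, ∫ u, z (dot (n j) u) * (legendre l).eval (dot u x) ∂area =
      2 * Real.pi * ∫ u, (legendre l).eval (dot u x) ∂area := by
    rw [← integral_finsetSum]
    · simp only [← Finset.sum_mul, hsum, integral_const_mul]
    · intro j _
      simp only [dot_comm _ x]
      exact integrable_of_continuous
        ((hz.comp (hd (n j))).mul ((legendre l).continuous.comp (hd x)))
  simp only [integral_comp_dot_mul_legendre hz, hzu,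
    integral_axialIntegral_mul_legendre hF R l, ← Finset.sum_mul] at key
  apply mul_left_cancel₀ Real.two_pi_pos.ne'
  rw [← key]
  ring

/-! ### From the harmonics to the frame condition -/

theorem integral_comp_dot (g : ℝ → ℝ) (v : S2) :
    ∫ u, g (dot v u) ∂area = ∫ u, g (u.1 2) ∂area := by
  obtain ⟨R, rfl⟩ := exists_rot_pole v
  rw [← integral_rot R]
  simp only [dot_rot_rot, dot_comm pole, dot_pole]

theorem continuous_dot_right (v : S2) : Continuous fun u => dot v u :=
  continuous_dot.comp (continuous_const.prodMk continuous_id)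

theorem integrable_eval_dot_mul {F : S2 → ℝ} (hF : Continuous F) (p : ℝ[X]) (v : S2) :
    Integrable (fun u => p.eval (dot v u) * F u) area :=
  integrable_of_continuous ((p.continuous.comp (continuous_dot_right v)).mul hF)

/-- Powers of `1 + u · v` form an approximate identity on the sphere. -/
theorem tendsto_integral_one_add_dot_pow {F : S2 → ℝ} (hF : Continuous F) (v : S2) :
    Filter.Tendsto (fun k : ℕ => (∫ u, (1 + u.1 2) ^ k ∂area)⁻¹ *
      ∫ u, (1 + dot v u) ^ k * F u ∂area) Filter.atTop (nhds (F v)) := by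
  have hc : Continuous fun u => 1 + dot v u := continuous_const.add (continuous_dot_right v)
  have h := tendsto_setIntegral_pow_smul_of_unique_maximum_of_isCompact_of_continuousOn
    (μ := area) (x₀ := v) (g := F) (c := fun u => 1 + dot v u) (isCompact_univ (X := S2))
    hc.continuousOn
    (fun y _ hy => by
      rw [dot_self]
      exact add_lt_add_right (lt_of_le_of_ne (abs_le.1 (abs_dot_le_one v y)).2
        fun h => hy (eq_of_dot_eq_one h).symm) 1)
    (fun y _ => by linarith [(abs_le.1 (abs_dot_le_one v y)).1])
    (by rw [dot_self]; norm_num) (by simp) hF.continuousOn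
  simp only [Measure.restrict_univ, smul_eq_mul] at h
  -- By rotation invariance the normalization does not depend on `v`.
  exact h.congr fun k => by rw [integral_comp_dot fun t => (1 + t) ^ k]

/-- The harmonic conditions imply that the values of `F` on all rotated copies of the directions
sum to one. -/
theorem sum_rot_eq_one {N : ℕ} (hN : N ≠ 0) {n : Fin N → S2} {F : S2 → ℝ} (hF : Continuous F)
    (h0 : ∫ u, F u ∂area = 4 * Real.pi / N)
    (h : ∀ l : ℕ, 1 ≤ l →
      (∀ y, zonal F l y = 0) ∨ ∀ x, ∑ j, (legendre l).eval (dot (n j) x) = 0) (R : SO3) :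
    ∑ j, F (rot R (n j)) = 1 := by
  have hN' : (N : ℝ) ≠ 0 := Nat.cast_ne_zero.2 hN
  -- For P_l with l ≥ 1 both sides are 0: either each integral vanishes, or the sum does under the
  -- integral sign, at the point R⁻¹u.
  have key (p : ℝ[X]) : ∑ j, ∫ u, p.eval (dot (rot R (n j)) u) * F u ∂area =
      ∫ u, p.eval (u.1 2) ∂area := by
    have hint (p : ℝ[X]) : Integrable (fun u : S2 => p.eval (u.1 2)) area :=
      integrable_of_continuous (p.continuous.comp (continuous_coord 2))
    induction mem_span_legendre p using Submodule.span_induction with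
    | mem p hp =>
      obtain ⟨l, rfl⟩ := hp
      rcases Nat.eq_zero_or_pos l with rfl | hl
      · simp only [legendre_zero, eval_one, one_mul, h0, integral_const, area_univ]
        simp
        field_simp
      · have hz : ∫ u : S2, (legendre l).eval (u.1 2) ∂area = 0 := by
          simpa only [dot_pole] using integral_legendre_dot hl pole
        rw [hz]
        rcases h l hl with h | h
        · exact Finset.sum_eq_zero fun j _ => h _
        · rw [← integral_finsetSum _ fun j _ => integrable_eval_dot_mul hF _ _]
          simp only [← Finset.sum_mul, dot_rot_left, h, zero_mul, integral_zero]
    | zero => simp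
    | add p q _ _ hp hq =>
      simp only [eval_add, add_mul]
      rw [integral_add (hint p) (hint q), ← hp, ← hq, ← Finset.sum_add_distrib]
      exact Finset.sum_congr rfl fun j _ =>
        integral_add (integrable_eval_dot_mul hF _ _) (integrable_eval_dot_mul hF _ _)
    | smul a p _ hp =>
      simp only [eval_smul, smul_eq_mul, mul_assoc, integral_const_mul, ← Finset.mul_sum, hp]
  have hlim := tendsto_finsetSum Finset.univ fun j _ =>
    tendsto_integral_one_add_dot_pow hF (rot R (n j))
  -- By `key`, the sums for F coincide with these averages of the constant 1.
  have hone := tendsto_integral_one_add_dot_pow (F := fun _ => 1) continuous_const pole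
  refine tendsto_nhds_unique hlim (hone.congr fun k => ?_)
  have hk := key ((1 + X) ^ k)
  simp only [eval_pow, eval_add, eval_one, eval_X] at hk
  rw [← Finset.mul_sum, hk]
  simp only [mul_one, dot_comm pole, dot_pole]

/-! ### Frame functions -/

theorem isFrameFunction_iff {N : ℕ} (n : Fin N → S2) (f : QubitOp → ℝ) :
    IsFrameFunction (rotationClass n) f ↔
      (∀ R : SO3, ∀ j, onSphere N f (rot R (n j)) ∈ Set.Icc (0 : ℝ) 1) ∧
        ∀ R : SO3, ∑ j, onSphere N f (rot R (n j)) = 1 := by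
  constructor
  · rintro ⟨h1, h2⟩
    exact ⟨fun R => h1 (fun j => blochEffect N (rotate R.1 (n j))) ⟨R.1, R.2, fun _ => rfl⟩,
      fun R => h2 (fun j => blochEffect N (rotate R.1 (n j))) ⟨R.1, R.2, fun _ => rfl⟩⟩
  · rintro ⟨h1, h2⟩
    constructor
    · rintro P ⟨R, hR, hP⟩ j
      rw [hP]
      exact h1 ⟨R, hR⟩ j
    · rintro P ⟨R, hR, hP⟩
      simp only [hP]
      exact h2 ⟨R, hR⟩

/-- A nonnegative function whose values on all rotated copies of the directions sum to one is a
frame function. -/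
theorem isFrameFunction_of_nonneg {N : ℕ} {n : Fin N → S2} {f : QubitOp → ℝ}
    (h0 : ∀ u, 0 ≤ onSphere N f u) (h1 : ∀ R : SO3, ∑ j, onSphere N f (rot R (n j)) = 1) :
    IsFrameFunction (rotationClass n) f := by
  refine (isFrameFunction_iff n f).2 ⟨fun R j => ⟨h0 _, ?_⟩, h1⟩
  rw [← h1 R]
  exact Finset.single_le_sum (f := fun j => onSphere N f (rot R (n j))) (fun j _ => h0 _)
    (Finset.mem_univ j)

theorem ne_zero_of_isPOVM {N : ℕ} {P : Fin N → QubitOp} (h : IsPOVM P) : N ≠ 0 := by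
  rintro rfl
  have := h.2
  simp at this

theorem harmonicCoeff_zero_iff {N : ℕ} (hN : N ≠ 0) (F : S2 → ℝ) :
    harmonicCoeff F 0 0 = ((Real.sqrt (4 * Real.pi) / N : ℝ) : ℂ) ↔
      ∫ u, F u ∂area = 4 * Real.pi / N := by
  have hN' : (N : ℝ) ≠ 0 := Nat.cast_ne_zero.2 hN
  have hs : Real.sqrt (4 * Real.pi) ≠ 0 := by positivity
  have hsq : Real.sqrt (4 * Real.pi) * Real.sqrt (4 * Real.pi) = 4 * Real.pi :=
    Real.mul_self_sqrt (by positivity)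
  rw [harmonicCoeff_zero_zero, Complex.ofReal_inj, div_eq_iff hs, div_mul_eq_mul_div, hsq]

/-- The frame conditions. -/
theorem isFrameFunction_iff_harmonic {N : ℕ} (hN : N ≠ 0) (n : Fin N → S2) {f : QubitOp → ℝ}
    (hf : Continuous (onSphere N f)) :
    IsFrameFunction (rotationClass n) f ↔
      (∀ u, 0 ≤ onSphere N f u) ∧
      harmonicCoeff (onSphere N f) 0 0 = ((Real.sqrt (4 * Real.pi) / N : ℝ) : ℂ) ∧
      ∀ l : ℕ, 1 ≤ l →
        (∀ m ∈ Set.Icc (-(l : ℤ)) l, harmonicCoeff (onSphere N f) l m = 0) ∨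
        SumCondition n l := by
  have hN' : (N : ℝ) ≠ 0 := Nat.cast_ne_zero.2 hN
  rw [harmonicCoeff_zero_iff hN]
  simp only [harmonicCoeff_eq_zero_iff hf, sumCondition_iff]
  constructor
  · intro h
    obtain ⟨h1, h2⟩ := (isFrameFunction_iff n f).1 h
    refine ⟨fun u => ?_, ?_, fun l hl => ?_⟩
    -- Rotations act transitively, so every point of the sphere occurs in some POVM of the class.
    · obtain ⟨R, rfl⟩ := exists_rot (n ⟨0, Nat.pos_of_ne_zero hN⟩) u
      exact (h1 R _).1
    · have h := zonal_mul_sum_legendre hf h2 0 pole pole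
      simp only [zonal_zero, legendre_zero, eval_one, integral_const, area_univ] at h
      rw [eq_div_iff hN']
      simpa using h
    · by_contra! hne
      obtain ⟨⟨y, hy⟩, x, hx⟩ := hne
      have h := zonal_mul_sum_legendre hf h2 l x y
      rw [integral_legendre_dot hl] at h
      exact mul_ne_zero hy hx h
  · rintro ⟨h1, h2, h3⟩
    exact isFrameFunction_of_nonneg h1 (sum_rot_eq_one hN hf h2 h3)

/-- The height of the Bloch vector is read off from the diagonal of the effect. -/
theorem blochEffect_height {N : ℕ} (hN : N ≠ 0) (u : S2) :
    (N : ℝ) * ((blochEffect N u 0 0).re - (blochEffect N u 1 1).re) / 2 = u.1 2 := by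
  have hN' : (N : ℝ) ≠ 0 := Nat.cast_ne_zero.2 hN
  have h : (1 / (N : ℂ)) = ((1 / N : ℝ) : ℂ) := by push_cast; rfl
  rw [blochEffect, h]
  simp [Fin.sum_univ_three, pauli, Matrix.smul_apply, Matrix.add_apply]
  field_simp
  ring

/-- Under the sum condition of degree `l` there is a frame function that contains the `l`-th
harmonic. -/
theorem exists_isFrameFunction_containsHarmonic {N : ℕ} (hN : N ≠ 0) {n : Fin N → S2} {l : ℕ}
    (hl : 1 ≤ l) (h : SumCondition n l) :
    ∃ f : QubitOp → ℝ, IsFrameFunction (rotationClass n) f ∧ Continuous (onSphere N f) ∧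
      ContainsHarmonic (onSphere N f) l := by
  have hN' : (0 : ℝ) < N := Nat.cast_pos.2 (Nat.pos_of_ne_zero hN)
  have hP : Continuous fun u : S2 => (legendre l).eval (u.1 2) :=
    (legendre l).continuous.comp (continuous_coord 2)
  obtain ⟨M, hM⟩ := (isCompact_univ (X := S2)).exists_bound_of_continuousOn hP.continuousOn
  have hM0 : 0 ≤ M := (norm_nonneg _).trans (hM pole trivial)
  -- On the sphere this is (1 + P_l(u_z)/(M + 1))/N, with the height read off from the operator. As
  -- |P_l| ≤ M, it is nonnegative, and M + 1 is never 0.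
  set f : QubitOp → ℝ := fun E =>
    1 / N * (1 + 1 / (M + 1) * (legendre l).eval (N * ((E 0 0).re - (E 1 1).re) / 2)) with hfdef
  have hF (u : S2) : onSphere N f u =
      1 / N * (1 + 1 / (M + 1) * (legendre l).eval (u.1 2)) := by
    rw [onSphere, hfdef]
    simp only [blochEffect_height hN]
  have hcont : Continuous (onSphere N f) := by
    rw [funext hF]
    exact continuous_const.mul (continuous_const.add (continuous_const.mul hP))
  refine ⟨f, isFrameFunction_of_nonneg (fun u => ?_) (fun R => ?_), hcont, ?_⟩
  · rw [hF]
    have h1 := (abs_le.1 (hM u trivial)).1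
    have h2 : -1 ≤ 1 / (M + 1) * (legendre l).eval (u.1 2) := by
      rw [one_div_mul_eq_div, le_div_iff₀ (by positivity)]
      linarith
    have : 0 ≤ 1 + 1 / (M + 1) * (legendre l).eval (u.1 2) := by linarith
    positivity
  · simp only [hF, ← dot_pole, dot_rot_left]
    rw [← Finset.mul_sum, Finset.sum_add_distrib, ← Finset.mul_sum, (sumCondition_iff n l).1 h]
    simp [hN]
  · have hP2 : Continuous fun u : S2 => (legendre l).eval (u.1 2) ^ 2 := hP.pow 2
    by_contra hne
    have hz : ∀ m ∈ Set.Icc (-(l : ℤ)) l, harmonicCoeff (onSphere N f) l m = 0 := by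
      intro m hm
      by_contra hm'
      exact hne ⟨m, hm, hm'⟩
    -- The zonal component at the pole is a positive multiple of ∫ P_l(u_z)² dΩ, hence not 0.
    have hz' := (harmonicCoeff_eq_zero_iff hcont l).1 hz pole
    have hsq : 0 < ∫ u : S2, (legendre l).eval (u.1 2) ^ 2 ∂area := by
      refine hP2.integral_pos_of_hasCompactSupport_nonneg_nonzero
        (HasCompactSupport.of_compactSpace _) (fun u => sq_nonneg _) (x := pole) ?_
      simp [pole, mkS2, legendre_eval_one]
    have h0 : ∫ u : S2, (legendre l).eval (u.1 2) ∂area = 0 := by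
      simpa only [dot_pole] using integral_legendre_dot hl pole
    have hval : zonal (onSphere N f) l pole =
        1 / N * (1 / (M + 1)) * ∫ u : S2, (legendre l).eval (u.1 2) ^ 2 ∂area := by
      have hsplit (u : S2) : (legendre l).eval (dot pole u) * onSphere N f u =
          1 / N * (legendre l).eval (u.1 2) +
            1 / N * (1 / (M + 1)) * (legendre l).eval (u.1 2) ^ 2 := by
        rw [hF, dot_comm, dot_pole]; ring
      simp only [zonal, hsplit]
      rw [integral_add ((integrable_of_continuous hP).const_mul _)
        ((integrable_of_continuous hP2).const_mul _), integral_const_mul, h0, mul_zero,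
        zero_add]
      exact integral_const_mul _ _
    rw [hval] at hz'
    have : 0 < 1 / N * (1 / (M + 1)) * ∫ u : S2, (legendre l).eval (u.1 2) ^ 2 ∂area := by
      positivity
    linarith

end QubitFrame

theorem mainTheorem3 (N : ℕ) (n : Fin N → QubitFrame.S2)
    (hn : QubitFrame.IsPOVM fun j => QubitFrame.blochEffect N (n j)) :
    (∀ f : QubitFrame.QubitOp → ℝ, Continuous (QubitFrame.onSphere N f) →
      (QubitFrame.IsFrameFunction (QubitFrame.rotationClass n) f ↔
        (∀ u, 0 ≤ QubitFrame.onSphere N f u) ∧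
        QubitFrame.harmonicCoeff (QubitFrame.onSphere N f) 0 0
          = ((Real.sqrt (4 * Real.pi) / N : ℝ) : ℂ) ∧
        ∀ l : ℕ, 1 ≤ l →
          (∀ m ∈ Set.Icc (-(l : ℤ)) l,
            QubitFrame.harmonicCoeff (QubitFrame.onSphere N f) l m = 0) ∨
          QubitFrame.SumCondition n l)) ∧
    ∀ l : ℕ, 1 ≤ l →
      ((∃ f : QubitFrame.QubitOp → ℝ,
          QubitFrame.IsFrameFunction (QubitFrame.rotationClass n) f ∧
          Continuous (QubitFrame.onSphere N f) ∧
          QubitFrame.ContainsHarmonic (QubitFrame.onSphere N f) l) ↔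
        QubitFrame.SumCondition n l) := by
  have hN := QubitFrame.ne_zero_of_isPOVM hn
  refine ⟨fun f hf => QubitFrame.isFrameFunction_iff_harmonic hN n hf, fun l hl => ⟨?_, fun h =>
    QubitFrame.exists_isFrameFunction_containsHarmonic hN hl h⟩⟩
  rintro ⟨f, hframe, hf, m, hm, hne⟩
  exact (((QubitFrame.isFrameFunction_iff_harmonic hN n hf).1 hframe).2.2 l hl).resolve_left
    fun h => hne (h m hm)
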